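/- Let $\dim$ denote Hausdorff dimension, with $\dim\emptyset=0$. Let $G(1,\mathbb{R}^3)$ be the set of one-dimensional linear subspaces of $\mathbb{R}^3$, with the metric $d(V,W)=\|\Pi_V-\Pi_W\|$, where $\Pi_W:\mathbb{R}^3\to W$ is the orthogonal projection onto $W$, viewed as a linear operator on $\mathbb{R}^3$, and $\|\cdot\|$ is the operator norm. For $A\subset\mathbb{R}^3$ and $s>0$ put $$E_s(A)=\{W\in G(1,\mathbb{R}^3):\dim(\Pi_W(A))<s\},$$ and for $0<a\le 3$ and $0<s<\min\{1,a\}$ put $$T(a,s)=\sup_{A\subset\mathbb{R}^3,\ \dim(A)=a}\dim(E_s(A)).$$ Let $0<a\le 3$ and $0<s<\min\{1,a\}$. Then: 1. If $a\le 1$, then $T(a,s)\ge 1$. 2. If $1<a\le 2$, then $$T(a,s)\ge\begin{cases}0 & \text{if } s\le\frac{a-1}{2},\\ 1+2s-a & \text{if } \frac{a-1}{2}<s\le a-1,\\ 1 & \text{if } a-1<s<1.\end{cases}$$ 3. If $2<a\le 3$, then $$T(a,s)\ge\begin{cases}0 & \text{if } s\le\frac{a-1}{2},\\ 1+2s-a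 & \text{if } \frac{a-1}{2}<s<1.\end{cases}$$ -/

import Mathlib

open scoped ENNReal

/-- The Grassmannian `G(k, ℝⁿ)` of `k`-dimensional linear subspaces of `ℝⁿ`. -/
def RealGrassmannian (n k : ℕ) : Type :=
  {W : Submodule ℝ (EuclideanSpace ℝ (Fin n)) // Module.finrank ℝ W = k}

/-- The orthogonal projection of `ℝⁿ` onto `W`, as an operator on `ℝⁿ`. -/
noncomputable def RealGrassmannian.proj {n k : ℕ} (W : RealGrassmannian n k) :
    EuclideanSpace ℝ (Fin n) →L[ℝ] EuclideanSpace ℝ (Fin n) :=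
  W.1.starProjection

theorem RealGrassmannian.proj_injective (n k : ℕ) :
    Function.Injective (RealGrassmannian.proj : RealGrassmannian n k → _) := by
  intro V W h
  exact Subtype.ext (Submodule.starProjection_inj.mp h)

/-- The standard metric on the Grassmannian: `d(V, W)` is the operator norm of the difference
of the orthogonal projections onto `V` and `W`. -/
noncomputable instance RealGrassmannian.instMetricSpace (n k : ℕ) :
    MetricSpace (RealGrassmannian n k) :=
  MetricSpace.induced RealGrassmannian.proj (RealGrassmannian.proj_injective n k) inferInstance

/-- The exceptional set `E_s(A) = {W ∈ G(k, ℝⁿ) : dim (Π_W A) < s}`, with `dim` the Hausdorff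
dimension. -/
def exceptionalSet (n k : ℕ) (s : ℝ) (A : Set (EuclideanSpace ℝ (Fin n))) :
    Set (RealGrassmannian n k) :=
  {W | dimH (W.proj '' A) < ENNReal.ofReal s}

/-- `T(a, s)`, the supremum of `dim E_s(A)` over all `A ⊆ ℝⁿ` with `dim A = a`, for projections
to `k`-dimensional subspaces. -/
noncomputable def supExceptionalDim (n k : ℕ) (a s : ℝ) : ℝ≥0∞ :=
  ⨆ (A : Set (EuclideanSpace ℝ (Fin n))) (_ : dimH A = ENNReal.ofReal a),
    dimH (exceptionalSet n k s A)

open MeasureTheory Filter Topology Metric Set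

/-! The zero cases are trivial. Otherwise test boxes `cantorBox σ` against the lines spanned by (0,
1, θ), along which projection is x₁ + θ x₂ up to scaling, so the first factor is lost.

If a - 1 < s, put as much dimension as possible in the first factor and take the third to be {0}:
every θ in [0, 1] is exceptional.

If (a - 1)/2 < s ≤ a - 1, take t < s close to s, β = a - 1 - t and γ = 1 + 2t - a, so β + γ = t. Use
factors of dimension 1, t, β and slopes θ in a set of dimension γ. At sparse scales 2⁻ⁿ these Cantor
sets look like grids of spacing about 2^(-tn), 2^(-βn), 2^(-γn). Products of the last two grids lie
in the first, so x₁ + θ x₂ stays near a grid of about 2^(tn) points and the projection has dimension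
at most t < s (`dimH_add_mul_cantorDigitSet_le`). The exceptional set thus has dimension at least γ,
and t → s gives 1 + 2s - a. -/

/-! ### Hausdorff dimension from covers and from measures. -/

/-- Hausdorff measure is bounded by a liminf over covers, so good covers along a sparse sequence of
scales suffice. -/
theorem dimH_le_of_frequent_covers {X : Type*} [MetricSpace X] {A : Set X} {t : ℝ} (C K : ℝ)
    (hC : 0 ≤ C) (N : ℕ → ℕ) (hN : Tendsto N atTop atTop)
    (h : ∀ d > t, ∀ᶠ k in atTop, ∃ F : Finset X, (F.card : ℝ) ≤ K * 2 ^ (d * N k) ∧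
      A ⊆ ⋃ x ∈ F, closedBall x (C * (1 / 2) ^ N k)) :
    dimH A ≤ ENNReal.ofReal t := by
  borelize X
  refine le_of_forall_gt_imp_ge_of_dense fun c hc => ?_
  rcases eq_or_ne c ⊤ with rfl | hct
  · exact le_top
  lift c to NNReal using hct
  have htc : t < c := by
    by_contra! hcon
    exact absurd (by simpa using ENNReal.ofReal_le_ofReal hcon) hc.not_ge
  apply dimH_le_of_hausdorffMeasure_ne_top
  obtain ⟨F, hF⟩ := (h c htc).choice
  have hrad : Tendsto (fun k => C * (1 / 2 : ℝ) ^ N k) atTop (𝓝 0) := by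
    have := ((tendsto_pow_atTop_nhds_zero_of_lt_one (r := (1 / 2 : ℝ)) (by norm_num)
      (by norm_num)).comp hN).const_mul C
    simpa using this
  have hr : Tendsto (fun k => ENNReal.ofReal (2 * (C * (1 / 2 : ℝ) ^ N k))) atTop (𝓝 0) := by
    have := ENNReal.tendsto_ofReal (hrad.const_mul 2)
    simpa using this
  have hdiam : ∀ k (x : X), ediam (closedBall x (C * (1 / 2 : ℝ) ^ N k)) ≤
      ENNReal.ofReal (2 * (C * (1 / 2 : ℝ) ^ N k)) := by
    intro k x
    rw [← Metric.closedEBall_ofReal (by positivity), ENNReal.ofReal_mul (p := 2) (by norm_num),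
      ENNReal.ofReal_ofNat]
    exact Metric.ediam_closedEBall_le
  have key := Measure.hausdorffMeasure_le_liminf_sum (ι := fun k => F k) (c : ℝ) A
    (fun k => ENNReal.ofReal (2 * (C * (1 / 2 : ℝ) ^ N k))) hr
    (fun k x => closedBall (x : X) (C * (1 / 2) ^ N k))
    (.of_forall fun k x => hdiam k x)
    (hF.mono fun k hk => by
      refine hk.2.trans ?_
      simp only [Set.iUnion_subset_iff]
      exact fun x hx => Set.subset_iUnion (fun y : F k => closedBall (y : X) _) ⟨x, hx⟩)
  have bound : ∀ᶠ k in atTop, ∑ i : F k, ediam (closedBall (i : X) (C * (1 / 2 : ℝ) ^ N k)) ^ (c : ℝ)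
      ≤ ENNReal.ofReal (K * (2 * C) ^ (c : ℝ)) := by
    filter_upwards [hF] with k hk
    calc _ ≤ ∑ i : F k, ENNReal.ofReal (2 * (C * (1 / 2 : ℝ) ^ N k)) ^ (c : ℝ) :=
          Finset.sum_le_sum fun i _ => ENNReal.rpow_le_rpow (hdiam k i) c.coe_nonneg
      _ = ENNReal.ofReal ((F k).card * (2 * (C * (1 / 2 : ℝ) ^ N k)) ^ (c : ℝ)) := by
          rw [ENNReal.ofReal_rpow_of_nonneg (by positivity) c.coe_nonneg,
            ENNReal.ofReal_mul (by positivity)]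
          simp
      _ ≤ _ := by
          apply ENNReal.ofReal_le_ofReal
          calc _ ≤ K * 2 ^ ((c : ℝ) * N k) * (2 * (C * (1 / 2 : ℝ) ^ N k)) ^ (c : ℝ) := by
                gcongr; exact hk.1
            _ = K * (2 * C) ^ (c : ℝ) := by
                rw [← mul_assoc 2 C, Real.mul_rpow (by positivity) (by positivity),
                  ← Real.rpow_natCast, ← Real.rpow_mul (by norm_num), one_div,
                  Real.inv_rpow (by norm_num), mul_comm (N k : ℝ)]
                field_simp
  refine ne_top_of_le_ne_top (b := ENNReal.ofReal (K * (2 * C) ^ (c : ℝ)))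
    ENNReal.ofReal_ne_top (key.trans ?_)
  exact (liminf_le_liminf bound).trans_eq (by simp)

/-- Mass distribution principle: a set of small diameter lies in a ball of that radius about any of
its points, whence C⁻¹ μ ≤ μH[t]. -/
theorem le_dimH_of_measure_closedBall_le {X : Type*} [MetricSpace X] [MeasurableSpace X]
    [BorelSpace X] (μ : Measure X) {A : Set X} (hA : μ A ≠ 0) {t C : ℝ} (hC : 0 < C)
    (h : ∀ x r, 0 < r → r ≤ 1 → μ (closedBall x r) ≤ ENNReal.ofReal (C * r ^ t)) :
    ENNReal.ofReal t ≤ dimH A := by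
  rcases le_or_gt t 0 with ht | ht
  · simp [ENNReal.ofReal_of_nonpos ht]
  have hle : (ENNReal.ofReal C)⁻¹ • μ ≤ μH[t] := by
    refine Measure.le_hausdorffMeasure t _ 1 one_pos fun s hs => ?_
    rcases s.eq_empty_or_nonempty with rfl | ⟨x, hx⟩
    · simp
    have hfin : ediam s ≠ ⊤ := ne_top_of_le_ne_top ENNReal.one_ne_top hs
    have hball : ∀ r, 0 < r → r ≤ 1 → diam s ≤ r →
        (ENNReal.ofReal C)⁻¹ * μ s ≤ ENNReal.ofReal (r ^ t) := by
      intro r hr hr1 hsr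
      have hsub : s ⊆ closedBall x r := fun y hy =>
        (Metric.dist_le_diam_of_mem' hfin hy hx).trans hsr
      calc _ ≤ (ENNReal.ofReal C)⁻¹ * ENNReal.ofReal (C * r ^ t) := by
            gcongr; exact (measure_mono hsub).trans (h x r hr hr1)
        _ = _ := by
            rw [ENNReal.ofReal_mul hC.le, ← mul_assoc, ENNReal.inv_mul_cancel (by simpa)
              ENNReal.ofReal_ne_top, one_mul]
    have hed : ediam s = ENNReal.ofReal (diam s) := (ENNReal.ofReal_toReal hfin).symm
    have hd1 : diam s ≤ 1 := by
      rw [hed] at hs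
      simpa using hs
    rw [Measure.smul_apply, smul_eq_mul, hed, ENNReal.ofReal_rpow_of_nonneg diam_nonneg ht.le]
    -- The hypothesis says nothing about radius 0, so diameter 0 is reached by letting r → 0⁺.
    rcases (diam_nonneg (s := s)).eq_or_lt with h0 | hpos
    · have hlim : Tendsto (fun r : ℝ => ENNReal.ofReal (r ^ t)) (𝓝[>] 0)
          (𝓝 (ENNReal.ofReal (0 ^ t))) := by
        apply ENNReal.tendsto_ofReal
        exact ((Real.continuousAt_rpow_const 0 t (Or.inr ht.le)).tendsto).mono_left
          nhdsWithin_le_nhds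
      rw [← h0]
      refine ge_of_tendsto hlim ?_
      filter_upwards [Ioc_mem_nhdsGT (zero_lt_one' ℝ)] with r hr
      exact hball r hr.1 hr.2 (h0 ▸ hr.1.le)
    · exact hball _ hpos hd1 le_rfl
  have hne : μH[(t.toNNReal : ℝ)] A ≠ 0 := by
    rw [Real.coe_toNNReal t ht.le]
    intro h0
    have := (hle A).trans_eq h0
    simp [hA] at this
  exact le_dimH_of_hausdorffMeasure_ne_zero hne

/-- Sup-metric balls are products of intervals, so exponents add under the product measure. -/
theorem le_dimH_pi_of_measure_closedBall_le {ι : Type*} [Fintype ι] (μ : ι → Measure ℝ)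
    [∀ i, IsFiniteMeasure (μ i)] {A : ι → Set ℝ} (hA : ∀ i, μ i (A i) ≠ 0) {t C : ι → ℝ}
    (hC : ∀ i, 0 < C i)
    (h : ∀ i x r, 0 < r → r ≤ 1 → μ i (closedBall x r) ≤ ENNReal.ofReal (C i * r ^ t i)) :
    ENNReal.ofReal (∑ i, t i) ≤ dimH (Set.univ.pi A) := by
  refine le_dimH_of_measure_closedBall_le (Measure.pi μ) ?_ (C := ∏ i, C i)
    (Finset.prod_pos fun i _ => hC i) fun x r hr hr1 => ?_
  · rw [Measure.pi_pi]
    exact Finset.prod_ne_zero_iff.2 fun i _ => hA i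
  · rw [closedBall_pi _ hr.le, Measure.pi_pi, Real.rpow_sum_of_pos hr t Finset.univ, ← Finset.prod_mul_distrib,
      ENNReal.ofReal_prod_of_nonneg fun i _ => mul_nonneg (hC i).le (by positivity)]
    exact Finset.prod_le_prod' fun i _ => h i (x i) r hr hr1

/-! ### Sets of reals with prescribed zero binary digits, and their measures. -/

/-- The reals in `[0, 1]` with a binary expansion whose digits vanish outside `S`. -/
def digitSet (S : Set ℕ) : Set ℝ :=
  Real.ofDigits '' {d : ℕ → Fin 2 | ∀ j ∉ S, d j = 0}

open Classical in
/-- The number of elements of `S` below `n`. -/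
noncomputable def countBelow (S : Set ℕ) (n : ℕ) : ℕ := Nat.count (· ∈ S) n

theorem countBelow_add_compl (S : Set ℕ) (n : ℕ) : countBelow S n + countBelow Sᶜ n = n := by
  classical
  induction n with
  | zero => simp [countBelow]
  | succ n ih =>
    simp only [countBelow, Nat.count_succ, Set.mem_compl_iff] at ih ⊢
    split_ifs <;> grind

theorem sum_ofDigitsTerm_le_ofDigits_le (d : ℕ → Fin 2) (n : ℕ) :
    ∑ i ∈ Finset.range n, Real.ofDigitsTerm d i ≤ Real.ofDigits d ∧
      Real.ofDigits d ≤ ∑ i ∈ Finset.range n, Real.ofDigitsTerm d i + (1 / 2) ^ n := by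
  rw [Real.ofDigits_eq_sum_add_ofDigits d n]
  have h0 := Real.ofDigits_nonneg (fun i => d (i + n))
  have h1 := Real.ofDigits_le_one (fun i => d (i + n))
  have hp : (0 : ℝ) < ((2 : ℕ) ^ n : ℝ)⁻¹ := by positivity
  have he : ((1 : ℝ) / 2) ^ n = ((2 : ℕ) ^ n : ℝ)⁻¹ := by simp
  rw [he]
  constructor
  · nlinarith
  · nlinarith

theorem exists_natCast_eq_sum_ofDigitsTerm {d : ℕ → Fin 2} {n m : ℕ}
    (h : ∀ j < n, d j ≠ 0 → j < m) :
    ∃ k : ℕ, ∑ i ∈ Finset.range n, Real.ofDigitsTerm d i = k * (1 / 2) ^ m := by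
  refine ⟨∑ i ∈ Finset.range n, (d i : ℕ) * 2 ^ (m - (i + 1)), ?_⟩
  rw [Nat.cast_sum, Finset.sum_mul]
  refine Finset.sum_congr rfl fun i hi => ?_
  by_cases hd : d i = 0
  · simp [Real.ofDigitsTerm, hd]
  · have him := h i (Finset.mem_range.1 hi) hd
    obtain ⟨c, rfl⟩ := Nat.exists_eq_add_of_lt him
    have : i + c + 1 - (i + 1) = c := by omega
    simp only [Real.ofDigitsTerm, this]
    push_cast
    rw [mul_assoc]
    congr 1
    rw [one_div, inv_pow, pow_add, pow_add, pow_add]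
    field_simp

theorem exists_finset_digitSet_cover (S : Set ℕ) (n : ℕ) :
    ∃ F : Finset ℝ, F.card ≤ 2 ^ countBelow S n ∧
      ∀ x ∈ digitSet S, ∃ p ∈ F, p ≤ x ∧ x ≤ p + (1 / 2) ^ n := by
  classical
  refine ⟨((Finset.range n).filter (· ∈ S)).powerset.image
    (fun P => ∑ i ∈ P, ((2 : ℝ) ^ (i + 1))⁻¹), ?_, ?_⟩
  · refine Finset.card_image_le.trans ?_
    rw [Finset.card_powerset, countBelow, Nat.count_eq_card_filter_range]
  · rintro _ ⟨d, hd, rfl⟩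
    refine ⟨_, Finset.mem_image_of_mem _ (a := (Finset.range n).filter (fun i => d i ≠ 0))
      (Finset.mem_powerset.2 ?_), ?_⟩
    · intro i hi
      simp only [Finset.mem_filter] at hi ⊢
      exact ⟨hi.1, by_contra fun h => hi.2 (hd i h)⟩
    · have : ∑ i ∈ (Finset.range n).filter (fun i => d i ≠ 0), ((2 : ℝ) ^ (i + 1))⁻¹ =
          ∑ i ∈ Finset.range n, Real.ofDigitsTerm d i := by
        rw [Finset.sum_filter]
        refine Finset.sum_congr rfl fun i _ => ?_
        have : d i = 0 ∨ d i = 1 := by omega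
        rcases this with h | h <;> simp [Real.ofDigitsTerm, h]
      rw [this]
      exact sum_ofDigitsTerm_le_ofDigits_le d n

theorem ofDigits_indicator_add_compl (S : Set ℕ) (d : ℕ → Fin 2) :
    Real.ofDigits (S.indicator d) + Real.ofDigits (Sᶜ.indicator d) = Real.ofDigits d := by
  simp only [Real.ofDigits]
  rw [← Summable.tsum_add Real.summable_ofDigitsTerm Real.summable_ofDigitsTerm]
  refine tsum_congr fun i => ?_
  by_cases h : i ∈ S <;> simp [Real.ofDigitsTerm, h]

theorem ofDigits_indicator_mem_digitSet (S : Set ℕ) (d : ℕ → Fin 2) :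
    Real.ofDigits (S.indicator d) ∈ digitSet S :=
  ⟨_, fun _ hj => Set.indicator_of_notMem hj _, rfl⟩

theorem measurable_ofDigits_indicator_digits (S : Set ℕ) :
    Measurable fun x : ℝ => Real.ofDigits (S.indicator (Real.digits x 2)) := by
  refine Real.continuous_ofDigits.measurable.comp (measurable_pi_iff.2 fun j => ?_)
  by_cases h : j ∈ S
  · simp only [Set.indicator_of_mem h, Real.digits]
    exact (measurable_from_nat (f := Fin.ofNat 2)).comp
      (Nat.measurable_floor.comp (measurable_id.mul_const _))
  · simp [h]

/-- The image of Lebesgue measure on `[0, 1)` under erasing the binary digits outside `S`. -/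
noncomputable def digitMeasure (S : Set ℕ) : Measure ℝ :=
  (volume.restrict (Ico 0 1)).map fun x : ℝ => Real.ofDigits (S.indicator (Real.digits x 2))

instance (S : Set ℕ) : IsFiniteMeasure (digitMeasure S) := by
  unfold digitMeasure
  infer_instance

theorem digitMeasure_digitSet_ne_zero (S : Set ℕ) : digitMeasure S (digitSet S) ≠ 0 := by
  have h := Measure.le_map_apply (μ := volume.restrict (Ico (0 : ℝ) 1))
    (measurable_ofDigits_indicator_digits S).aemeasurable (digitSet S)
  have hu : (fun x : ℝ => Real.ofDigits (S.indicator (Real.digits x 2))) ⁻¹' digitSet S =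
      univ := eq_univ_of_forall fun x => ofDigits_indicator_mem_digitSet S _
  rw [hu] at h
  intro h0
  rw [digitMeasure] at h0
  rw [h0] at h
  simp at h

/-- A point of [0, 1) is the sum of its `S`-part and its `Sᶜ`-part. Fixing the first up to 2⁻ⁿ
leaves `2 ^ countBelow Sᶜ n` choices of the second up to 2⁻ⁿ, so the preimage is covered by that
many intervals of length 2 · 2⁻ⁿ. -/
theorem digitMeasure_Icc_le (S : Set ℕ) (n : ℕ) (v : ℝ) :
    digitMeasure S (Icc v (v + (1 / 2) ^ n)) ≤
      ENNReal.ofReal (2 * (1 / 2) ^ countBelow S n) := by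
  rw [digitMeasure, Measure.map_apply (measurable_ofDigits_indicator_digits S) measurableSet_Icc,
    Measure.restrict_apply (measurable_ofDigits_indicator_digits S measurableSet_Icc)]
  obtain ⟨F, hFc, hF⟩ := exists_finset_digitSet_cover Sᶜ n
  have hsub : (fun x : ℝ => Real.ofDigits (S.indicator (Real.digits x 2))) ⁻¹'
      Icc v (v + (1 / 2) ^ n) ∩ Ico 0 1 ⊆
      ⋃ p ∈ F, Icc (v + p) (v + p + 2 * (1 / 2) ^ n) := by
    rintro x ⟨hx, hx1⟩
    obtain ⟨p, hp, hp1, hp2⟩ := hF _ (ofDigits_indicator_mem_digitSet Sᶜ (Real.digits x 2))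
    have hsum := ofDigits_indicator_add_compl S (Real.digits x 2)
    rw [Real.ofDigits_digits one_lt_two hx1] at hsum
    simp only [mem_preimage, mem_Icc] at hx
    simp only [mem_iUnion, mem_Icc]
    exact ⟨p, hp, by linarith [hx.1], by linarith [hx.2]⟩
  refine (measure_mono hsub).trans ((measure_biUnion_finset_le F _).trans ?_)
  have hvol : ∀ p, volume (Icc (v + p) (v + p + 2 * (1 / 2) ^ n)) =
      ENNReal.ofReal (2 * (1 / 2) ^ n) := fun p => by
    rw [Real.volume_Icc]; congr 1; ring
  simp only [hvol, Finset.sum_const, nsmul_eq_mul]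
  rw [← ENNReal.ofReal_natCast, ← ENNReal.ofReal_mul (by positivity)]
  apply ENNReal.ofReal_le_ofReal
  calc (F.card : ℝ) * (2 * (1 / 2) ^ n) ≤ 2 ^ countBelow Sᶜ n * (2 * (1 / 2) ^ n) := by
        gcongr; exact_mod_cast hFc
    _ = 2 * (1 / 2) ^ countBelow S n := by
        nth_rw 2 [← countBelow_add_compl S n]
        rw [pow_add, one_div, inv_pow, inv_pow]
        field_simp

theorem digitMeasure_closedBall_le {S : Set ℕ} {σ : ℝ} (hσ : 0 ≤ σ) (hσ1 : σ ≤ 1)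
    (hS : ∀ n, σ * n - 1 ≤ countBelow S n) (x r : ℝ) (hr : 0 < r) (hr1 : r ≤ 1) :
    digitMeasure S (closedBall x r) ≤ ENNReal.ofReal (16 * r ^ σ) := by
  obtain ⟨n, hn1, hn2⟩ := exists_nat_pow_near_of_lt_one (y := (1 / 2 : ℝ)) hr hr1
    (by norm_num) (by norm_num)
  have hsub : closedBall x r ⊆ Icc (x - r) (x - r + (1 / 2) ^ n) ∪
      Icc (x - r + (1 / 2) ^ n) (x - r + (1 / 2) ^ n + (1 / 2) ^ n) := by
    intro y hy
    rw [Real.closedBall_eq_Icc] at hy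
    rcases le_total y (x - r + (1 / 2) ^ n) with h | h
    · exact Or.inl ⟨hy.1, h⟩
    · exact Or.inr ⟨h, by linarith [hy.2]⟩
  have hpow : ((1 : ℝ) / 2) ^ countBelow S n ≤ 4 * r ^ σ := by
    calc ((1 : ℝ) / 2) ^ countBelow S n = (1 / 2 : ℝ) ^ (countBelow S n : ℝ) :=
          (Real.rpow_natCast _ _).symm
      -- One unit is lost in `hS`, and at most one more in replacing n by n + 1, as σ ≤ 1.
      _ ≤ (1 / 2 : ℝ) ^ (σ * (n + 1) + (-2)) := by
          apply Real.rpow_le_rpow_of_exponent_ge (by norm_num) (by norm_num)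
          linarith [hS n]
      _ = 4 * ((1 / 2 : ℝ) ^ (n + 1)) ^ σ := by
          rw [Real.rpow_add (by norm_num), ← Real.rpow_natCast, ← Real.rpow_mul (by norm_num)]
          have : ((1 : ℝ) / 2) ^ (-2 : ℝ) = 4 := by
            rw [Real.rpow_neg (by norm_num)]; norm_num
          rw [this]
          push_cast
          rw [mul_comm σ, mul_comm]
      _ ≤ _ := by gcongr
  calc _ ≤ _ := (measure_mono hsub).trans (measure_union_le _ _)
    _ ≤ _ := add_le_add (digitMeasure_Icc_le S n _) (digitMeasure_Icc_le S n _)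
    _ ≤ _ := by
      rw [← ENNReal.ofReal_add (by positivity) (by positivity)]
      apply ENNReal.ofReal_le_ofReal
      linarith

/-! ### Digit positions of density σ arranged in rapidly growing blocks. -/

/-- A rapidly increasing sequence of scales starting at `0`. -/
def digitScale (k : ℕ) : ℕ := k.factorial - 1

theorem digitScale_add_one (k : ℕ) : digitScale k + 1 = k.factorial :=
  Nat.sub_add_cancel k.factorial_pos

/-- Makes all the digits before a block negligible compared with its end. -/
theorem succ_mul_digitScale_le (k : ℕ) : (k + 1) * digitScale k ≤ digitScale (k + 1) := by
  have h1 := digitScale_add_one k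
  have h2 := digitScale_add_one (k + 1)
  rw [Nat.factorial_succ, ← h1] at h2
  nlinarith

theorem monotone_digitScale : Monotone digitScale := fun _ _ h =>
  Nat.sub_le_sub_right (Nat.factorial_le h) 1

theorem tendsto_digitScale : Tendsto digitScale atTop atTop := by
  refine tendsto_atTop_mono (fun n => ?_) (tendsto_sub_atTop_nat 1)
  exact Nat.sub_le_sub_right (Nat.self_le_factorial n) 1

/-- The number of free positions between two consecutive scales. -/
noncomputable def freeLength (σ : ℝ) (k : ℕ) : ℕ :=
  ⌊σ * digitScale (k + 1)⌋₊ - ⌊σ * digitScale k⌋₊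

/-- A set of positions of density `σ` at every scale `digitScale k`, concentrated at the beginning
of each block. -/
def freePositions (σ : ℝ) : Set ℕ :=
  {j | ∃ k, digitScale k ≤ j ∧ j < digitScale k + freeLength σ k}

theorem floor_mul_digitScale_le {σ : ℝ} (hσ : 0 ≤ σ) (k : ℕ) :
    ⌊σ * digitScale k⌋₊ ≤ ⌊σ * digitScale (k + 1)⌋₊ := by
  gcongr
  exact monotone_digitScale k.le_succ

theorem freeLength_le {σ : ℝ} (hσ : 0 ≤ σ) (hσ1 : σ ≤ 1) (k : ℕ) :
    digitScale k + freeLength σ k ≤ digitScale (k + 1) := by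
  have hm : digitScale k ≤ digitScale (k + 1) := monotone_digitScale k.le_succ
  obtain ⟨c, hc⟩ := Nat.exists_eq_add_of_le hm
  have : ⌊σ * digitScale (k + 1)⌋₊ ≤ ⌊σ * digitScale k⌋₊ + c := by
    rw [← Nat.floor_add_natCast (by positivity)]
    apply Nat.floor_le_floor
    rw [hc]
    push_cast
    nlinarith [Nat.cast_nonneg (α := ℝ) c]
  unfold freeLength
  omega

theorem mem_freePositions_iff {σ : ℝ} (hσ : 0 ≤ σ) (hσ1 : σ ≤ 1) {k j : ℕ}
    (hkj : digitScale k ≤ j) (hjk : j < digitScale (k + 1)) :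
    j ∈ freePositions σ ↔ j < digitScale k + freeLength σ k := by
  refine ⟨?_, fun h => ⟨k, hkj, h⟩⟩
  rintro ⟨l, hl, hl'⟩
  have h1 := hl'.trans_le (freeLength_le hσ hσ1 l)
  have h2 : l < k + 1 := by
    by_contra! h
    exact absurd (monotone_digitScale h) (by omega)
  have h3 : k < l + 1 := by
    by_contra! h
    exact absurd (monotone_digitScale h) (by omega)
  obtain rfl : l = k := by omega
  exact hl'

/-- The source of the grid structure: up to the end of block `k`, every free digit precedes the
block or lies in its initial run. -/
theorem lt_of_mem_freePositions {σ : ℝ} (hσ : 0 ≤ σ) (hσ1 : σ ≤ 1) {k j : ℕ}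
    (hj : j ∈ freePositions σ) (hjk : j < digitScale (k + 1)) :
    j < digitScale k + ⌊σ * digitScale (k + 1)⌋₊ := by
  rcases lt_or_ge j (digitScale k) with h | h
  · omega
  · have := (mem_freePositions_iff hσ hσ1 h hjk).1 hj
    have : freeLength σ k ≤ ⌊σ * digitScale (k + 1)⌋₊ := Nat.sub_le _ _
    omega

theorem countBelow_freePositions_add {σ : ℝ} (hσ : 0 ≤ σ) (hσ1 : σ ≤ 1) {k : ℕ}
    (hk : countBelow (freePositions σ) (digitScale k) = ⌊σ * digitScale k⌋₊) (d : ℕ)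
    (hd : digitScale k + d ≤ digitScale (k + 1)) :
    countBelow (freePositions σ) (digitScale k + d) =
      ⌊σ * digitScale k⌋₊ + min d (freeLength σ k) := by
  induction d with
  | zero => simpa using hk
  | succ d ih =>
    have hiff := mem_freePositions_iff hσ hσ1 (k := k) (j := digitScale k + d) (by omega) (by omega)
    have ih := ih (by omega)
    unfold countBelow at ih ⊢
    rw [← add_assoc, Nat.count_succ, ih]
    split_ifs with h
    · rw [hiff] at h; omega
    · rw [hiff] at h; omega

theorem countBelow_freePositions_digitScale {σ : ℝ} (hσ : 0 ≤ σ) (hσ1 : σ ≤ 1) (k : ℕ) :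
    countBelow (freePositions σ) (digitScale k) = ⌊σ * digitScale k⌋₊ := by
  induction k with
  | zero => simp [countBelow, digitScale]
  | succ k ih =>
    have hm : digitScale k ≤ digitScale (k + 1) := monotone_digitScale k.le_succ
    obtain ⟨c, hc⟩ := Nat.exists_eq_add_of_le hm
    have := countBelow_freePositions_add hσ hσ1 ih c hc.ge
    rw [← hc] at this
    rw [this]
    have h1 := freeLength_le hσ hσ1 k
    have h2 := floor_mul_digitScale_le hσ k
    rw [min_eq_right (by omega)]
    unfold freeLength
    omega

/-- Inside a block the count first grows with slope 1 ≥ σ, then stays at its final value; since the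
free digits come first, it never falls below the line of slope σ by more than rounding. -/
theorem le_countBelow_freePositions {σ : ℝ} (hσ : 0 ≤ σ) (hσ1 : σ ≤ 1) (n : ℕ) :
    σ * n - 1 ≤ countBelow (freePositions σ) n := by
  obtain ⟨k, hk, hk'⟩ : ∃ k, digitScale k ≤ n ∧ n < digitScale (k + 1) := by
    classical
    have hex : ∃ k, n < digitScale k := (tendsto_digitScale.eventually_gt_atTop n).exists
    obtain ⟨k, hk⟩ : ∃ k, Nat.find hex = k + 1 := Nat.exists_eq_succ_of_ne_zero fun h => by
      have := Nat.find_spec hex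
      rw [h] at this
      simp [digitScale] at this
    exact ⟨k, not_lt.1 (Nat.find_min hex (by omega)), hk ▸ Nat.find_spec hex⟩
  obtain ⟨d, rfl⟩ := Nat.exists_eq_add_of_le hk
  rw [countBelow_freePositions_add hσ hσ1 (countBelow_freePositions_digitScale hσ hσ1 k) d hk'.le]
  rcases le_total d (freeLength σ k) with h | h
  · rw [min_eq_left h]
    have := Nat.lt_floor_add_one (σ * digitScale k)
    push_cast
    nlinarith [Nat.cast_nonneg (α := ℝ) d]
  · rw [min_eq_right h]
    have h2 := floor_mul_digitScale_le hσ k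
    have : ⌊σ * digitScale k⌋₊ + freeLength σ k = ⌊σ * digitScale (k + 1)⌋₊ := by
      unfold freeLength; omega
    rw [this]
    have h3 := Nat.lt_floor_add_one (σ * digitScale (k + 1))
    have h4 : ((digitScale k + d : ℕ) : ℝ) ≤ digitScale (k + 1) := by exact_mod_cast hk'.le
    nlinarith

theorem freePositions_zero : freePositions 0 = ∅ := by
  ext j
  simp [freePositions, freeLength]

/-! ### Grid-like Cantor sets, their products and sums. -/

/-- A Cantor type set of dimension `σ` whose binary digits at the scales `digitScale k` look like
those of a fine grid. -/
def cantorDigitSet (σ : ℝ) : Set ℝ := digitSet (freePositions σ)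

theorem cantorDigitSet_zero : cantorDigitSet 0 = {0} := by
  rw [cantorDigitSet, freePositions_zero, digitSet]
  have : {d : ℕ → Fin 2 | ∀ j ∉ (∅ : Set ℕ), d j = 0} = {0} := by
    ext d
    simp [funext_iff]
  rw [this, image_singleton]
  simp [Real.ofDigits, Real.ofDigitsTerm]

theorem cantorDigitSet_subset_Icc (σ : ℝ) : cantorDigitSet σ ⊆ Icc 0 1 := by
  rintro _ ⟨d, -, rfl⟩
  exact ⟨Real.ofDigits_nonneg d, Real.ofDigits_le_one d⟩

theorem exists_grid_near_of_mem_cantorDigitSet {σ : ℝ} (hσ : 0 ≤ σ) (hσ1 : σ ≤ 1) {x : ℝ}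
    (hx : x ∈ cantorDigitSet σ) (k : ℕ) :
    ∃ a : ℕ, a * (1 / 2) ^ (digitScale k + ⌊σ * digitScale (k + 1)⌋₊) ≤ x ∧
      x ≤ a * (1 / 2) ^ (digitScale k + ⌊σ * digitScale (k + 1)⌋₊) +
        (1 / 2) ^ digitScale (k + 1) := by
  obtain ⟨d, hd, rfl⟩ := hx
  obtain ⟨a, ha⟩ := exists_natCast_eq_sum_ofDigitsTerm (d := d) (n := digitScale (k + 1))
    (m := digitScale k + ⌊σ * digitScale (k + 1)⌋₊) fun j hj hdj =>
      lt_of_mem_freePositions hσ hσ1 (by_contra fun h => hdj (hd j h)) hj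
  exact ⟨a, ha ▸ sum_ofDigitsTerm_le_ofDigits_le d _⟩

/-- Covers at the scales `digitScale k` bound the dimension above; the product of the digit measures
bounds it below. -/
theorem dimH_pi_cantorDigitSet {ι : Type*} [Fintype ι] {σ : ι → ℝ} (h0 : ∀ i, 0 ≤ σ i)
    (h1 : ∀ i, σ i ≤ 1) :
    dimH (univ.pi fun i => cantorDigitSet (σ i)) = ENNReal.ofReal (∑ i, σ i) := by
  classical
  apply le_antisymm
  · refine dimH_le_of_frequent_covers 1 1 zero_le_one digitScale tendsto_digitScale
      fun d hd => .of_forall fun k => ?_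
    choose F hFc hF using fun i => exists_finset_digitSet_cover (freePositions (σ i)) (digitScale k)
    refine ⟨Fintype.piFinset F, ?_, ?_⟩
    · rw [Fintype.card_piFinset, one_mul]
      calc ((∏ i, (F i).card : ℕ) : ℝ)
          ≤ ∏ i, (2 : ℝ) ^ (σ i * digitScale k) := by
            push_cast
            refine Finset.prod_le_prod (fun _ _ => by positivity) fun i _ => ?_
            calc ((F i).card : ℝ) ≤ 2 ^ ⌊σ i * digitScale k⌋₊ := by
                  rw [← countBelow_freePositions_digitScale (h0 i) (h1 i)]
                  exact_mod_cast hFc i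
              _ ≤ _ := by
                  rw [← Real.rpow_natCast]
                  exact Real.rpow_le_rpow_of_exponent_le one_le_two
                    (Nat.floor_le (mul_nonneg (h0 i) (by positivity)))
        _ = (2 : ℝ) ^ ((∑ i, σ i) * digitScale k) := by
            rw [Finset.sum_mul, Real.rpow_sum_of_pos two_pos]
        _ ≤ _ := by
            apply Real.rpow_le_rpow_of_exponent_le one_le_two
            gcongr
    · intro x hx
      choose p hp hp1 hp2 using fun i => hF i (x i) (hx i (mem_univ i))
      simp only [mem_iUnion]
      refine ⟨p, Fintype.mem_piFinset.2 hp, ?_⟩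
      rw [mem_closedBall, one_mul, dist_pi_le_iff (by positivity)]
      intro i
      rw [Real.dist_eq, abs_le]
      constructor
      · linarith [hp1 i, show (0 : ℝ) < (1 / 2) ^ digitScale k by positivity]
      · linarith [hp2 i]
  · exact le_dimH_pi_of_measure_closedBall_le (fun i => digitMeasure (freePositions (σ i)))
      (fun i => digitMeasure_digitSet_ne_zero _) (C := fun _ => 16) (fun _ => by norm_num)
      fun i x r hr hr1 => digitMeasure_closedBall_le (h0 i) (h1 i)
        (le_countBelow_freePositions (h0 i) (h1 i)) x r hr hr1

theorem dimH_cantorDigitSet {σ : ℝ} (h0 : 0 ≤ σ) (h1 : σ ≤ 1) :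
    dimH (cantorDigitSet σ) = ENNReal.ofReal σ := by
  have h := dimH_pi_cantorDigitSet (ι := Unit) (σ := fun _ => σ) (fun _ => h0) (fun _ => h1)
  have he : (ContinuousLinearEquiv.funUnique Unit ℝ ℝ) ''
      (univ.pi fun _ : Unit => cantorDigitSet σ) = cantorDigitSet σ := by
    ext x
    constructor
    · rintro ⟨y, hy, rfl⟩
      exact hy () trivial
    · exact fun hx => ⟨fun _ => x, fun _ _ => hx, rfl⟩
  rw [← he, ContinuousLinearEquiv.dimH_image, h]
  simp

/-- Sums `x + θ y` of grid-like digit sets stay in a coarse grid when the densities are additive. -/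
theorem dimH_add_mul_cantorDigitSet_le {β γ θ : ℝ} (hβ : 0 ≤ β) (hγ : 0 ≤ γ) (hs1 : β + γ ≤ 1)
    (hθ : θ ∈ cantorDigitSet γ) :
    dimH ((fun p : ℝ × ℝ => p.1 + θ * p.2) '' (cantorDigitSet (β + γ) ×ˢ cantorDigitSet β)) ≤
      ENNReal.ofReal (β + γ) := by
  classical
  refine dimH_le_of_frequent_covers 3 4 (by norm_num) (fun k => digitScale (k + 1))
    (tendsto_digitScale.comp (tendsto_add_atTop_nat 1)) fun d hd => ?_
  -- For such k the excess `2 * digitScale k` in the exponent `M` is at most (d - (β + γ)) n.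
  have hev : ∀ᶠ k : ℕ in atTop, 2 / (d - (β + γ)) ≤ k :=
    tendsto_natCast_atTop_atTop.eventually_ge_atTop _
  filter_upwards [hev] with k hk
  set n := digitScale (k + 1) with hn
  -- A common grid for x and θ y: θ and y each contribute one `digitScale k`, and their floors add
  -- up to at most ⌊(β + γ) n⌋.
  set M := 2 * digitScale k + ⌊(β + γ) * n⌋₊ with hM
  -- The approximating grid points lie in [0, 2].
  refine ⟨(Finset.range (2 * 2 ^ M + 1)).image fun a : ℕ => a * (1 / 2 : ℝ) ^ M, ?_, ?_⟩
  · have hcard : (((Finset.range (2 * 2 ^ M + 1)).image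
        fun a : ℕ => a * (1 / 2 : ℝ) ^ M).card : ℝ) ≤ 2 * 2 ^ M + 1 := by
      have := Finset.card_image_le (s := Finset.range (2 * 2 ^ M + 1))
        (f := fun a : ℕ => a * (1 / 2 : ℝ) ^ M)
      rw [Finset.card_range] at this
      exact_mod_cast this
    have hone : (1 : ℝ) ≤ 2 ^ M := one_le_pow₀ one_le_two
    have hexp : (2 : ℝ) ^ M ≤ 2 ^ (d * n) := by
      rw [← Real.rpow_natCast]
      apply Real.rpow_le_rpow_of_exponent_le one_le_two
      have h1 : ((k : ℝ) + 1) * digitScale k ≤ n := by exact_mod_cast succ_mul_digitScale_le k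
      have h2 := Nat.floor_le (show 0 ≤ (β + γ) * n by positivity)
      have h3 : 2 ≤ k * (d - (β + γ)) := (div_le_iff₀ (by linarith)).1 hk
      rw [hM]
      push_cast
      have h4 : (k : ℝ) * (d - (β + γ)) * digitScale k ≤ (d - (β + γ)) * n := by
        nlinarith [Nat.cast_nonneg (α := ℝ) (digitScale k)]
      nlinarith [Nat.cast_nonneg (α := ℝ) (digitScale k)]
    linarith
  · rintro _ ⟨⟨x, y⟩, ⟨hx, hy⟩, rfl⟩
    dsimp only at hx hy ⊢
    have hxI := cantorDigitSet_subset_Icc _ hx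
    have hyI := cantorDigitSet_subset_Icc _ hy
    have hθI := cantorDigitSet_subset_Icc _ hθ
    obtain ⟨a, ha, ha'⟩ := exists_grid_near_of_mem_cantorDigitSet (by positivity) hs1 hx k
    obtain ⟨b, hb, hb'⟩ := exists_grid_near_of_mem_cantorDigitSet hβ (by linarith) hy k
    obtain ⟨c, hc, hc'⟩ := exists_grid_near_of_mem_cantorDigitSet hγ (by linarith) hθ k
    rw [← hn] at ha ha' hb hb' hc hc'
    set ma := digitScale k + ⌊(β + γ) * n⌋₊
    set mb := digitScale k + ⌊β * n⌋₊
    set mc := digitScale k + ⌊γ * n⌋₊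
    have hma : ma ≤ M := by omega
    have hmbc : mb + mc ≤ M := by
      have : ⌊β * n⌋₊ + ⌊γ * n⌋₊ ≤ ⌊(β + γ) * n⌋₊ := by
        apply Nat.le_floor
        push_cast
        have h1 := Nat.floor_le (show 0 ≤ β * n by positivity)
        have h2 := Nat.floor_le (show 0 ≤ γ * n by positivity)
        linarith
      omega
    obtain ⟨ea, hea⟩ := Nat.exists_eq_add_of_le hma
    obtain ⟨eb, heb⟩ := Nat.exists_eq_add_of_le hmbc
    have hpow (i j : ℕ) : (1 / 2 : ℝ) ^ i = 2 ^ j * (1 / 2) ^ (i + j) := by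
      rw [pow_add, mul_left_comm, ← mul_pow]
      norm_num
    have hgrid : a * (1 / 2 : ℝ) ^ ma + c * (1 / 2 : ℝ) ^ mc * (b * (1 / 2 : ℝ) ^ mb) =
        ((a * 2 ^ ea + b * c * 2 ^ eb : ℕ) : ℝ) * (1 / 2) ^ M := by
      push_cast
      rw [hpow ma ea, ← hea, mul_mul_mul_comm, ← pow_add, add_comm mc, hpow (mb + mc) eb, ← heb]
      ring
    set p := a * (1 / 2 : ℝ) ^ ma
    set q := b * (1 / 2 : ℝ) ^ mb
    set u := c * (1 / 2 : ℝ) ^ mc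
    have hp0 : 0 ≤ p := by positivity
    have hq0 : 0 ≤ q := by positivity
    have hu0 : 0 ≤ u := by positivity
    have huq : u * q ≤ θ * y := by gcongr; exact hθI.1
    -- θ y - u q = (θ - u) y + u (y - q), with y and u at most 1. With the error in x this gives
    -- radius 3 · 2⁻ⁿ.
    have huq' : θ * y ≤ u * q + 2 * (1 / 2) ^ n := by
      have : (0 : ℝ) ≤ (1 / 2) ^ n := by positivity
      nlinarith [hyI.1, hyI.2, hθI.1, hθI.2]
    have hθy : θ * y ≤ 1 := mul_le_one₀ hθI.2 hyI.1 hyI.2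
    simp only [mem_iUnion]
    refine ⟨p + u * q, Finset.mem_image.2 ⟨_, Finset.mem_range.2 (Nat.lt_succ_of_le ?_),
      hgrid.symm⟩, ?_⟩
    · have h2 : ((a * 2 ^ ea + b * c * 2 ^ eb : ℕ) : ℝ) * (1 / 2) ^ M ≤ 2 := by
        rw [← hgrid]; linarith [hxI.2]
      rw [one_div, inv_pow, ← div_eq_mul_inv, div_le_iff₀ (by positivity)] at h2
      exact_mod_cast h2
    · rw [mem_closedBall, Real.dist_eq, abs_le]
      constructor
      · have : (0 : ℝ) ≤ (1 / 2) ^ n := by positivity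
        linarith
      · linarith

/-! ### The curve of lines spanned by (0, 1, θ). -/

/-- The vector `(0, 1, θ)`. -/
noncomputable def slopeVector (θ : ℝ) : EuclideanSpace ℝ (Fin 3) := !₂[0, 1, θ]

theorem slopeVector_ne_zero (θ : ℝ) : slopeVector θ ≠ 0 := fun h => by
  simpa [slopeVector] using congrArg (fun v : EuclideanSpace ℝ (Fin 3) => v 1) h

theorem inner_slopeVector (θ : ℝ) (x : EuclideanSpace ℝ (Fin 3)) :
    inner ℝ (slopeVector θ) x = x 1 + θ * x 2 := by
  simp [slopeVector, PiLp.inner_apply, Fin.sum_univ_three, mul_comm]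

/-- The line spanned by `(0, 1, θ)`. -/
noncomputable def slopeLine (θ : ℝ) : RealGrassmannian 3 1 :=
  ⟨Submodule.span ℝ {slopeVector θ}, finrank_span_singleton (slopeVector_ne_zero θ)⟩

theorem slopeLine_proj_apply (θ : ℝ) (x : EuclideanSpace ℝ (Fin 3)) :
    (slopeLine θ).proj x = ((x 1 + θ * x 2) / ‖slopeVector θ‖ ^ 2) • slopeVector θ := by
  rw [RealGrassmannian.proj, slopeLine, Submodule.starProjection_singleton, inner_slopeVector]
  simp

/-- Apply the difference of the projections to (0, 1, θ) and pair with (0, -θ', 1), which is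
orthogonal to the second line: the result is θ - θ', and both vectors have norm at most √2. -/
theorem abs_sub_le_two_mul_dist_slopeLine {θ θ' : ℝ} (h : θ ∈ Icc (0 : ℝ) 1)
    (h' : θ' ∈ Icc (0 : ℝ) 1) : |θ - θ'| ≤ 2 * dist (slopeLine θ) (slopeLine θ') := by
  set u : EuclideanSpace ℝ (Fin 3) := !₂[0, -θ', 1] with hu
  have hinner (x : EuclideanSpace ℝ (Fin 3)) : inner ℝ u x = -θ' * x 1 + x 2 := by
    simp [hu, PiLp.inner_apply, Fin.sum_univ_three, mul_comm]
  have hself : (slopeLine θ).proj (slopeVector θ) = slopeVector θ :=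
    Submodule.starProjection_eq_self_iff.2 (Submodule.mem_span_singleton_self _)
  have horth : inner ℝ u ((slopeLine θ').proj (slopeVector θ)) = 0 := by
    rw [slopeLine_proj_apply, inner_smul_right, hinner]
    simp [slopeVector]
  have hdiff : θ - θ' =
      inner ℝ u (((slopeLine θ).proj - (slopeLine θ').proj) (slopeVector θ)) := by
    rw [sub_apply, inner_sub_right, horth, hself, hinner]
    simp [slopeVector]
    ring
  have hdist : dist (slopeLine θ) (slopeLine θ') =
      ‖(slopeLine θ).proj - (slopeLine θ').proj‖ :=
    dist_eq_norm (slopeLine θ).proj (slopeLine θ').proj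
  have hnu : ‖u‖ ≤ √2 := by
    rw [EuclideanSpace.norm_eq]
    apply Real.sqrt_le_sqrt
    simp [hu, Fin.sum_univ_three]
    nlinarith [h'.1, h'.2]
  have hnv : ‖slopeVector θ‖ ≤ √2 := by
    rw [EuclideanSpace.norm_eq]
    apply Real.sqrt_le_sqrt
    simp [slopeVector, Fin.sum_univ_three]
    nlinarith [h.1, h.2]
  calc |θ - θ'| ≤ ‖u‖ * ‖((slopeLine θ).proj - (slopeLine θ').proj) (slopeVector θ)‖ := by
        rw [hdiff]; exact abs_real_inner_le_norm _ _
    _ ≤ √2 * (‖(slopeLine θ).proj - (slopeLine θ').proj‖ * √2) := by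
        gcongr
        exact (ContinuousLinearMap.le_opNorm _ _).trans (by gcongr)
    _ = 2 * dist (slopeLine θ) (slopeLine θ') := by
        rw [hdist, mul_left_comm, Real.mul_self_sqrt zero_le_two, mul_comm]

/-- Antilipschitz maps do not lower dimension. -/
theorem dimH_le_of_slopeLine_mem {Θ : Set ℝ} {E : Set (RealGrassmannian 3 1)}
    (hΘ : Θ ⊆ Icc 0 1) (h : ∀ θ ∈ Θ, slopeLine θ ∈ E) : dimH Θ ≤ dimH E := by
  have hanti : AntilipschitzWith 2 fun θ : Θ => slopeLine θ :=
    AntilipschitzWith.of_le_mul_dist fun x y => by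
      simpa [Subtype.dist_eq, Real.dist_eq] using
        abs_sub_le_two_mul_dist_slopeLine (hΘ x.2) (hΘ y.2)
  calc dimH Θ = dimH ((Subtype.val : Θ → ℝ) '' univ) := by simp
    _ = dimH (univ : Set Θ) := isometry_subtype_coe.dimH_image univ
    _ ≤ _ := hanti.le_dimH_image univ
    _ ≤ dimH E := dimH_mono (by rintro _ ⟨θ, -, rfl⟩; exact h θ θ.2)

/-! ### Boxes with many exceptional lines, and the lower bounds. -/

/-- The product of three Cantor type digit sets, as a subset of Euclidean space. -/
noncomputable def cantorBox (σ : Fin 3 → ℝ) : Set (EuclideanSpace ℝ (Fin 3)) :=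
  (EuclideanSpace.equiv (Fin 3) ℝ).symm '' univ.pi fun i => cantorDigitSet (σ i)

theorem dimH_cantorBox {σ : Fin 3 → ℝ} (h0 : ∀ i, 0 ≤ σ i) (h1 : ∀ i, σ i ≤ 1) :
    dimH (cantorBox σ) = ENNReal.ofReal (σ 0 + σ 1 + σ 2) := by
  rw [cantorBox, ContinuousLinearEquiv.dimH_image, dimH_pi_cantorDigitSet h0 h1,
    Fin.sum_univ_three]

theorem dimH_slopeLine_proj_image_cantorBox_le (σ : Fin 3 → ℝ) (θ : ℝ) :
    dimH ((slopeLine θ).proj '' cantorBox σ) ≤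
      dimH ((fun p : ℝ × ℝ => p.1 + θ * p.2) ''
        (cantorDigitSet (σ 1) ×ˢ cantorDigitSet (σ 2))) := by
  have hlip := (ContinuousLinearMap.toSpanSingleton ℝ
    ((1 / ‖slopeVector θ‖ ^ 2) • slopeVector θ)).lipschitz
  refine le_trans (dimH_mono ?_) (hlip.dimH_image_le _)
  rintro _ ⟨_, ⟨x, hx, rfl⟩, rfl⟩
  refine ⟨x 1 + θ * x 2, ⟨(x 1, x 2), ⟨hx 1 trivial, hx 2 trivial⟩, rfl⟩, ?_⟩
  rw [slopeLine_proj_apply, ContinuousLinearMap.toSpanSingleton_apply, smul_smul, mul_one_div]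
  rfl

theorem dimH_le_supExceptionalDim {σ : Fin 3 → ℝ} {a s : ℝ} {Θ : Set ℝ} (h0 : ∀ i, 0 ≤ σ i)
    (h1 : ∀ i, σ i ≤ 1) (ha : σ 0 + σ 1 + σ 2 = a) (hΘ : Θ ⊆ Icc 0 1)
    (h : ∀ θ ∈ Θ, dimH ((fun p : ℝ × ℝ => p.1 + θ * p.2) ''
      (cantorDigitSet (σ 1) ×ˢ cantorDigitSet (σ 2))) < ENNReal.ofReal s) :
    dimH Θ ≤ supExceptionalDim 3 1 a s :=
  (dimH_le_of_slopeLine_mem (E := exceptionalSet 3 1 s (cantorBox σ)) hΘ fun θ hθ =>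
    (dimH_slopeLine_proj_image_cantorBox_le σ θ).trans_lt (h θ hθ)).trans
    (le_iSup₂_of_le (cantorBox σ) (ha ▸ dimH_cantorBox h0 h1) le_rfl)

theorem one_le_supExceptionalDim {a s : ℝ} (ha : 0 < a) (ha2 : a ≤ 2) (hs : 0 < s)
    (has : a - 1 < s) : 1 ≤ supExceptionalDim 3 1 a s := by
  have hI : dimH (Icc (0 : ℝ) 1) = 1 := by
    rw [Real.dimH_of_nonempty_interior (by simp)]
    simp
  have hm : a - min a 1 = max 0 (a - 1) := by
    rcases le_total a 1 with h | h
    · rw [min_eq_left h, max_eq_left (by linarith)]; ring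
    · rw [min_eq_right h, max_eq_right (by linarith)]
  have hτ0 : 0 ≤ a - min a 1 := hm ▸ le_max_left _ _
  have hτ1 : a - min a 1 ≤ 1 := hm ▸ max_le zero_le_one (by linarith)
  rw [← hI]
  refine dimH_le_supExceptionalDim (σ := ![min a 1, a - min a 1, 0]) ?_ ?_ ?_ subset_rfl
    fun θ _ => ?_
  · intro i; fin_cases i
    · simp [ha.le]
    · exact hτ0
    · simp
  · intro i; fin_cases i
    · simp
    · exact hτ1
    · simp
  · simp
  · simp only [Matrix.cons_val, cantorDigitSet_zero]
    have : (fun p : ℝ × ℝ => p.1 + θ * p.2) '' (cantorDigitSet (a - min a 1) ×ˢ {0}) ⊆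
        cantorDigitSet (a - min a 1) := by
      rintro _ ⟨⟨x, y⟩, ⟨hx, hy⟩, rfl⟩
      obtain rfl : y = 0 := hy
      simpa using hx
    refine (dimH_mono this).trans_lt ?_
    rw [dimH_cantorDigitSet hτ0 hτ1, ENNReal.ofReal_lt_ofReal_iff hs, hm]
    exact max_lt hs has

theorem ofReal_le_supExceptionalDim {a s : ℝ} (ha : 1 < a) (hs : (a - 1) / 2 < s)
    (hsa : s ≤ a - 1) (hs1 : s < 1) :
    ENNReal.ofReal (1 + 2 * s - a) ≤ supExceptionalDim 3 1 a s := by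
  -- Exceptional lines need dimension strictly below s, hence t < s and a limit.
  have key : ∀ᶠ t in 𝓝[<] s, ENNReal.ofReal (1 + 2 * t - a) ≤ supExceptionalDim 3 1 a s := by
    filter_upwards [Ioo_mem_nhdsLT hs] with t ht
    have hβ : 0 ≤ a - 1 - t := by linarith [ht.2]
    have hγ : 0 ≤ 1 + 2 * t - a := by linarith [ht.1]
    have hβγ : a - 1 - t + (1 + 2 * t - a) = t := by ring
    rw [← dimH_cantorDigitSet hγ (by linarith [ht.1, ht.2])]
    refine dimH_le_supExceptionalDim (σ := ![1, t, a - 1 - t]) ?_ ?_ ?_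
      (cantorDigitSet_subset_Icc _) fun θ hθ => ?_
    · intro i; fin_cases i <;> simp <;> linarith [ht.1, ht.2]
    · intro i; fin_cases i <;> simp <;> linarith [ht.1, ht.2]
    · simp
    · have := dimH_add_mul_cantorDigitSet_le hβ hγ (by linarith [ht.2]) hθ
      rw [hβγ] at this
      refine this.trans_lt ?_
      rw [ENNReal.ofReal_lt_ofReal_iff (by linarith)]
      exact ht.2
  refine le_of_tendsto (ENNReal.tendsto_ofReal ?_) key
  exact (Continuous.tendsto (by fun_prop) s).mono_left nhdsWithin_le_nhds

theorem proposition2p3 (a s : ℝ) (ha : 0 < a) (ha3 : a ≤ 3) (hs : 0 < s) (hsa : s < min 1 a) :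
    (a ≤ 1 → 1 ≤ supExceptionalDim 3 1 a s) ∧
    (1 < a → a ≤ 2 →
      (s ≤ (a - 1) / 2 → 0 ≤ supExceptionalDim 3 1 a s) ∧
      ((a - 1) / 2 < s → s ≤ a - 1 →
        ENNReal.ofReal (1 + 2 * s - a) ≤ supExceptionalDim 3 1 a s) ∧
      (a - 1 < s → s < 1 → 1 ≤ supExceptionalDim 3 1 a s)) ∧
    (2 < a → a ≤ 3 →
      (s ≤ (a - 1) / 2 → 0 ≤ supExceptionalDim 3 1 a s) ∧
      ((a - 1) / 2 < s → s < 1 →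
        ENNReal.ofReal (1 + 2 * s - a) ≤ supExceptionalDim 3 1 a s)) := by
  have hs1 : s < 1 := hsa.trans_le (min_le_left _ _)
  exact ⟨fun h => one_le_supExceptionalDim ha (by linarith) hs (by linarith),
    fun h1 h2 => ⟨fun _ => zero_le,
      fun h3 h4 => ofReal_le_supExceptionalDim h1 h3 h4 hs1,
      fun h3 _ => one_le_supExceptionalDim ha h2 hs h3⟩,
    fun h2 _ => ⟨fun _ => zero_le,
      -- For a > 2 the condition s ≤ a - 1 is automatic, as s < 1 < a - 1.
      fun h3 _ => ofReal_le_supExceptionalDim (by linarith) h3 (by linarith) hs1⟩⟩
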